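/- A \emph{kissing configuration} in $\mathbb{R}^n$ is a set of unit spheres, each externally tangent to the unit sphere $S^{n-1}$ centred at the origin, whose interiors are pairwise disjoint. The \emph{kissing number} $\kappa(n)$ is the maximal size of a kissing configuration in $\mathbb{R}^n$. Then \[ \kappa(25)\ge 197048,\quad \kappa(26)\ge 198512,\quad \kappa(27)\ge 199976,\quad \kappa(28)\ge 204368, \] \[ \kappa(29)\ge 208272,\quad \kappa(30)\ge 219984,\quad \kappa(31)\ge 232874 . \] -/

import Mathlib

/-- A kissing configuration in `ℝⁿ`: a set of unit spheres, each externally tangent to the unit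
sphere centred at the origin, no two of which overlap (the open balls that they bound are
disjoint). -/
structure IsKissingConfiguration (n : ℕ)
    (X : Set (EuclideanGeometry.Sphere (EuclideanSpace ℝ (Fin n)))) : Prop where
  radius_eq_one : ∀ s ∈ X, s.radius = 1
  isExtTangent : ∀ s ∈ X, s.IsExtTangent ⟨0, 1⟩
  nonoverlapping : X.Pairwise fun s t =>
    Disjoint (Metric.ball s.center s.radius) (Metric.ball t.center t.radius)

/-- The kissing number in `ℝⁿ`: the largest size of a kissing configuration in `ℝⁿ`. It is taken
in `ℕ∞`, where every set of sizes has a supremum, so that no default value can occur. -/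
noncomputable def kissingNumber (n : ℕ) : ℕ∞ :=
  sSup {k : ℕ∞ | ∃ X : Set (EuclideanGeometry.Sphere (EuclideanSpace ℝ (Fin n))),
    IsKissingConfiguration n X ∧ X.encard = k}

open Finset

set_option linter.constructorNameAsVariable false

/-! The construction modifies the kissing configuration of the Leech lattice. Let `V` be the 196560
minimal vectors, scaled to squared norm 32, so that distinct ones have inner product at most 16.
Inside `V` lie 64 disjoint layers of 512 vectors with pairwise inner products at most 8. In the
extra `d` dimensions take a code with angles at least 60°, labelled so that points with equal labels
are at least 120° apart. For each label in use, delete its layer from `V` and put back one copy over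
every code point with that label: the layer vector is shrunk to squared norm 8/3 and a multiple of
the code point, of squared norm 4/3, is added. All inner products stay at most 2 against squared
norm 4 (`le_kissingNumber_of_layers`).

A label used by the three vertices of an equilateral triangle gains 2 · 512 = 1024 spheres, so one
wants many disjoint triangles in a 60° code. The root systems A₂, D₃, D₄, E₆, E₇ split completely
into 2, 4, 8, 24, 42 triangles, and D₅ contains 12 disjoint ones; in one dimension an antipodal pair
gains 512.

The bound 16 on `V` amounts to the minimal norm of the Leech lattice (`IsLeech.le_sum_sq`), which
rests on the Golay code being linear, containing the all-ones word, and having weights divisible by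
4 with none equal to 4. The layers consist of vectors `(∓3, ±1²³)` whose sign words run over cosets
of a 5-dimensional Golay subcode, one coset for each of 16 positions of the 3; translating the sign
words by a complementary 6-dimensional subcode gives the 64 disjoint layers. -/

/-- Finitely many vectors of squared norm `4` with pairwise inner products at most `2` are the
centres of a kissing configuration. -/
theorem card_le_kissingNumber {ι κ : Type*} [Fintype κ] {n : ℕ} (hn : Fintype.card κ = n)
    (I : Finset ι) (v : ι → κ → ℝ) (hv : ∀ i ∈ I, ∑ k, v i k * v i k = 4)
    (hvw : ∀ i ∈ I, ∀ j ∈ I, i ≠ j → ∑ k, v i k * v j k ≤ 2) :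
    (#I : ℕ∞) ≤ kissingNumber n := by
  let e : Fin n ≃ κ := (Fintype.equivFinOfCardEq hn).symm
  let c : ι → EuclideanSpace ℝ (Fin n) := fun i => WithLp.toLp 2 fun k => v i (e k)
  have hdist : ∀ i ∈ I, ∀ j ∈ I, i ≠ j → 2 ≤ dist (c i) (c j) := by
    intro i hi j hj hij
    rw [EuclideanSpace.dist_eq]
    apply Real.le_sqrt_of_sq_le
    have h : ∑ k, dist ((c i).ofLp k) ((c j).ofLp k) ^ 2
        = ∑ k, v i k * v i k + ∑ k, v j k * v j k - 2 * ∑ k, v i k * v j k := by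
      rw [← e.sum_comp (fun k => v i k * v i k), ← e.sum_comp (fun k => v j k * v j k),
        ← e.sum_comp (fun k => v i k * v j k), mul_sum, ← sum_add_distrib, ← sum_sub_distrib]
      refine sum_congr rfl fun k _ => ?_
      rw [Real.dist_eq, sq_abs]
      simp only [c]
      ring
    rw [h, hv i hi, hv j hj]
    linarith [hvw i hi j hj hij]
  have hnorm : ∀ i ∈ I, dist (c i) 0 = 2 := by
    intro i hi
    have h : ∑ k, ‖(c i).ofLp k‖ ^ 2 = 2 ^ 2 := by
      rw [← (by norm_num : (4 : ℝ) = 2 ^ 2), ← hv i hi, ← e.sum_comp (fun k => v i k * v i k)]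
      refine sum_congr rfl fun k _ => ?_
      rw [Real.norm_eq_abs, sq_abs, sq]
    rw [dist_zero_right, EuclideanSpace.norm_eq, h, Real.sqrt_sq (by norm_num)]
  let f : ι → EuclideanGeometry.Sphere (EuclideanSpace ℝ (Fin n)) := fun i => ⟨c i, 1⟩
  have hf : Set.InjOn f I := by
    intro i hi j hj hij
    by_contra hne
    have h := hdist i hi j hj hne
    have : c i = c j := congrArg EuclideanGeometry.Sphere.center hij
    rw [this, dist_self] at h
    norm_num at h
  refine le_sSup ⟨f '' I, ⟨?_, ?_, ?_⟩, ?_⟩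
  · rintro _ ⟨i, -, rfl⟩
    rfl
  · rintro _ ⟨i, hi, rfl⟩
    rw [EuclideanGeometry.Sphere.isExtTangent_iff_dist_center]
    refine ⟨?_, by norm_num [f], by norm_num⟩
    change dist (c i) 0 = 1 + 1
    rw [hnorm i hi]
    norm_num
  · rintro _ ⟨i, hi, rfl⟩ _ ⟨j, hj, rfl⟩ hne
    apply Metric.ball_disjoint_ball
    change (1 : ℝ) + 1 ≤ dist (c i) (c j)
    have := hdist i hi j hj (fun h => hne (h ▸ rfl))
    linarith
  · rw [hf.encard_image, Set.encard_coe_eq_coe_finsetCard]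

/-! ### Labelled codes and the lifting construction. -/

/-- The inner product of two integer vectors for the diagonal form with coefficients `c`. -/
def weightedDot : List ℕ → List ℤ → List ℤ → ℤ
  | c :: cs, x :: xs, y :: ys => c * (x * y) + weightedDot cs xs ys
  | _, _, _ => 0

theorem sum_eq_weightedDot (c : List ℕ) (x y : List ℤ) (hx : x.length = c.length)
    (hy : y.length = c.length) :
    ∑ k : Fin c.length, (c.get k : ℤ) * (x.getD k 0 * y.getD k 0) = weightedDot c x y := by
  induction c generalizing x y with
  | nil => simp [weightedDot]
  | cons c cs ih =>
    obtain ⟨x, xs, rfl⟩ := List.exists_cons_of_length_eq_add_one hx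
    obtain ⟨y, ys, rfl⟩ := List.exists_cons_of_length_eq_add_one hy
    have := ih xs ys (by simpa using hx) (by simpa using hy)
    simp only [List.length_cons, Fin.sum_univ_succ, weightedDot, ← this]
    simp

/-- A list of points on the sphere of squared radius `N` for the diagonal form with coefficients
`c`, each carrying a label: distinct points have angle at least `60°`, and at least `120°` when
their labels agree. -/
structure IsLabelledCode (c : List ℕ) (N : ℕ) (P : List (ℕ × List ℤ)) : Prop where
  length_eq : ∀ p ∈ P, p.2.length = c.length
  norm_eq : ∀ p ∈ P, weightedDot c p.2 p.2 = N
  pairwise : P.Pairwise fun p q =>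
    2 * weightedDot c p.2 q.2 ≤ if p.1 = q.1 then -(N : ℤ) else N

theorem weightedDot_comm (c : List ℕ) (x y : List ℤ) : weightedDot c x y = weightedDot c y x := by
  induction c generalizing x y with
  | nil => simp [weightedDot]
  | cons c cs ih =>
    cases x <;> cases y <;> simp only [weightedDot]
    rw [ih, mul_comm (_ : ℤ) (_ : ℤ)]
    ring

theorem IsLabelledCode.weightedDot_le {c : List ℕ} {N : ℕ} {P : List (ℕ × List ℤ)}
    (h : IsLabelledCode c N P) {a b : Fin P.length} (hab : a ≠ b) :
    2 * weightedDot c (P.get a).2 (P.get b).2 ≤ if (P.get a).1 = (P.get b).1 then -(N : ℤ)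
      else N := by
  have hp := List.pairwise_iff_getElem.1 h.pairwise
  rcases lt_or_gt_of_ne hab with hlt | hlt
  · exact hp a b a.2 b.2 hlt
  · have := hp b a b.2 a.2 hlt
    rw [weightedDot_comm]
    simpa only [List.get_eq_getElem, eq_comm] using this

/-- Points of a spherical code `V` (squared norm `32`, inner products at most `16`) that belong to
one of the disjoint subcodes `S j` (inner products at most `8`) are lifted over the points labelled
`j` of a labelled code in `ℝᵈ`. -/
theorem le_kissingNumber_of_layers {m s : ℕ} (V : Finset (Fin m → ℤ)) (S : ℕ → Finset (Fin m → ℤ))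
    (l : ℕ) (hV : ∀ x ∈ V, ∑ k, x k * x k = 32)
    (hVV : ∀ x ∈ V, ∀ y ∈ V, x ≠ y → ∑ k, x k * y k ≤ 16)
    (hSV : ∀ j < l, S j ⊆ V) (hS : ∀ j < l, #(S j) = s)
    (hdisj : ∀ i < l, ∀ j < l, i ≠ j → Disjoint (S i) (S j))
    (hSS : ∀ j < l, ∀ x ∈ S j, ∀ y ∈ S j, x ≠ y → ∑ k, x k * y k ≤ 8)
    {c : List ℕ} {N : ℕ} (hN : 0 < N) {P : List (ℕ × List ℤ)} (hP : IsLabelledCode c N P)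
    (hl : ∀ p ∈ P, p.1 < l) :
    ((#V - l * s + P.length * s : ℕ) : ℕ∞) ≤ kissingNumber (m + c.length) := by
  classical
  set U := (range l).biUnion S with hU
  have hUV : U ⊆ V := biUnion_subset.2 fun j hj => hSV j (mem_range.1 hj)
  have hUc : #U = l * s := by
    rw [hU, card_biUnion, sum_congr rfl fun j hj => hS j (mem_range.1 hj)]
    · simp
    · intro i hi j hj hij
      exact hdisj i (mem_range.1 hi) j (mem_range.1 hj) hij
  have hlab : ∀ a : Fin P.length, (P.get a).1 < l := fun a => hl _ (List.get_mem P a)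
  let R : Finset (Σ _ : Fin P.length, Fin m → ℤ) := univ.sigma fun a => S (P.get a).1
  have hR : #R = P.length * s := by
    rw [card_sigma, sum_congr rfl fun a _ => hS _ (hlab a)]
    simp
  -- The truncated subtraction is exact because `U ⊆ V`.
  have hcard : #((V \ U).disjSum R) = #V - l * s + P.length * s := by
    rw [card_disjSum, card_sdiff_of_subset hUV, hUc, hR]
  rw [← hcard]
  have hNR : (0 : ℝ) < N := by exact_mod_cast hN
  -- Untouched vectors get squared norm 32/8 = 4. Lifted ones get 32/12 = 8/3 from the shrunk part,
  -- and `γ` rescales the code from squared norm `N` to 4/3.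
  let α : ℝ := √(1 / 8)
  let β : ℝ := √(1 / 12)
  let γ : Fin c.length → ℝ := fun k => √(4 * c.get k / (3 * N))
  have hα : α * α = 1 / 8 := Real.mul_self_sqrt (by norm_num)
  have hβ : β * β = 1 / 12 := Real.mul_self_sqrt (by norm_num)
  have hαβ : α * β ≤ 1 / 8 := by
    rw [← hα]
    exact mul_le_mul_of_nonneg_left (Real.sqrt_le_sqrt (by norm_num)) (Real.sqrt_nonneg _)
  have hαβ0 : 0 ≤ α * β := mul_nonneg (Real.sqrt_nonneg _) (Real.sqrt_nonneg _)
  have hγ : ∀ k, γ k * γ k = 4 * c.get k / (3 * N) := fun k => Real.mul_self_sqrt (by positivity)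
  let w : (Fin m → ℤ) ⊕ (Σ _ : Fin P.length, Fin m → ℤ) → Fin m ⊕ Fin c.length → ℝ :=
    Sum.elim (fun x => Sum.elim (fun k => α * x k) fun _ => 0)
      (fun r => Sum.elim (fun k => β * r.2 k) fun k => γ k * (((P.get r.1).2.getD k 0 : ℤ) : ℝ))
  have hll : ∀ x y, ∑ k, w (.inl x) k * w (.inl y) k = 1 / 8 * ((∑ k, x k * y k : ℤ) : ℝ) := by
    intro x y
    simp only [Fintype.sum_sum_type, w, Sum.elim_inl, Sum.elim_inr, mul_zero, sum_const_zero,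
      add_zero, Int.cast_sum, mul_sum, Int.cast_mul, ← hα]
    exact sum_congr rfl fun k _ => by ring
  have hlr : ∀ x r, ∑ k, w (.inl x) k * w (.inr r) k = α * β * ((∑ k, x k * r.2 k : ℤ) : ℝ) := by
    intro x r
    simp only [Fintype.sum_sum_type, w, Sum.elim_inl, Sum.elim_inr, zero_mul, sum_const_zero,
      add_zero, Int.cast_sum, mul_sum, Int.cast_mul]
    exact sum_congr rfl fun k _ => by ring
  have hrr : ∀ r t, ∑ k, w (.inr r) k * w (.inr t) k = 1 / 12 * ((∑ k, r.2 k * t.2 k : ℤ) : ℝ)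
      + 4 / (3 * N) * (weightedDot c (P.get r.1).2 (P.get t.1).2 : ℤ) := by
    intro r t
    rw [← sum_eq_weightedDot c _ _ (hP.length_eq _ (List.get_mem P r.1))
      (hP.length_eq _ (List.get_mem P t.1))]
    simp only [Fintype.sum_sum_type, w, Sum.elim_inl, Sum.elim_inr, Int.cast_sum, mul_sum,
      Int.cast_mul, ← hβ]
    congr 1
    · exact sum_congr rfl fun k _ => by ring
    · refine sum_congr rfl fun k _ => ?_
      rw [mul_mul_mul_comm, hγ]
      push_cast
      ring
  have key : ∀ {A B a b : ℝ}, A ≤ a → 2 * B ≤ b * N → 1 / 12 * a + 2 / 3 * b ≤ 2 →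
      1 / 12 * A + 4 / (3 * N) * B ≤ 2 := by
    intro A B a b hA hB hab
    have : 4 / (3 * N) * B = 2 / 3 * (2 * B / N) := by field_simp; ring
    have h2 : 2 * B / N ≤ b := by rwa [div_le_iff₀ hNR]
    rw [this]
    linarith
  have hmem : ∀ r ∈ R, r.2 ∈ S (P.get r.1).1 := fun r hr => (mem_sigma.1 hr).2
  have hlr' : ∀ x ∈ V \ U, ∀ r ∈ R, ∑ k, w (.inl x) k * w (.inr r) k ≤ 2 := by
    intro x hx r hr
    rw [mem_sdiff] at hx
    have hrU : r.2 ∈ U := mem_biUnion.2 ⟨_, mem_range.2 (hlab r.1), hmem r hr⟩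
    have h := hVV x hx.1 r.2 (hUV hrU) (fun h => hx.2 (h ▸ hrU))
    have h' : ((∑ k, x k * r.2 k : ℤ) : ℝ) ≤ 16 := by exact_mod_cast h
    rw [hlr]
    calc _ ≤ α * β * 16 := mul_le_mul_of_nonneg_left h' hαβ0
      _ ≤ 2 := by linarith
  refine card_le_kissingNumber (by simp) _ w ?_ ?_
  · rintro (x | r) h
    · rw [hll, hV x (mem_sdiff.1 (inl_mem_disjSum.1 h)).1]
      norm_num
    · have h' := hmem r (inr_mem_disjSum.1 h)
      rw [hrr, hV _ (hSV _ (hlab _) h'), hP.norm_eq _ (List.get_mem P r.1)]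
      push_cast
      field_simp
      norm_num
  · rintro (x | r) hx (y | t) hy hne
    · rw [inl_mem_disjSum, mem_sdiff] at hx hy
      have h := hVV x hx.1 y hy.1 (fun h => hne (h ▸ rfl))
      have h' : ((∑ k, x k * y k : ℤ) : ℝ) ≤ 16 := by exact_mod_cast h
      rw [hll]
      linarith
    · exact hlr' x (inl_mem_disjSum.1 hx) t (inr_mem_disjSum.1 hy)
    · simp only [mul_comm (w (.inr r) _)]
      exact hlr' y (inl_mem_disjSum.1 hy) r (inr_mem_disjSum.1 hx)
    · have hr := hmem r (inr_mem_disjSum.1 hx)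
      have ht := hmem t (inr_mem_disjSum.1 hy)
      rw [hrr]
      obtain ⟨a, x⟩ := r
      obtain ⟨b, y⟩ := t
      dsimp only at hr ht ⊢
      have hxV := hSV _ (hlab a) hr
      have hyV := hSV _ (hlab b) ht
      -- The three cases are tight. Same code point: 8/12 + 4/3 = 2. Same layer vector over two
      -- points, whose labels must agree because the layers are disjoint: 32/12 - 2/3 = 2. Both
      -- different: 16/12 + 2/3 = 2.
      by_cases hab : a = b
      · subst hab
        have hxy : x ≠ y := fun h => hne (h ▸ rfl)
        refine key (a := 8) (b := 2) (by exact_mod_cast hSS _ (hlab a) x hr y ht hxy) ?_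
          (by norm_num)
        rw [hP.norm_eq _ (List.get_mem P a)]
        push_cast
        linarith
      · have hd := hP.weightedDot_le hab
        by_cases hxy : x = y
        · subst hxy
          have hL : (P.get a).1 = (P.get b).1 := by
            by_contra hL
            exact disjoint_left.1 (hdisj _ (hlab a) _ (hlab b) hL) hr ht
          rw [if_pos hL] at hd
          refine key (a := 32) (b := -1) (by exact_mod_cast (hV x hxV).le) ?_ (by norm_num)
          rw [neg_one_mul]
          exact_mod_cast hd
        · refine key (a := 16) (b := 1) (by exact_mod_cast hVV x hxV y hyV hxy) ?_ (by norm_num)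
          rw [one_mul]
          have hdN : 2 * weightedDot c (P.get a).2 (P.get b).2 ≤ N := by
            refine hd.trans ?_
            split_ifs
            · have : (0 : ℤ) ≤ N := by positivity
              linarith
            · exact le_rfl
          exact_mod_cast hdN

/-! ### Binary linear codes, with words as natural numbers. -/

/-- The translate by `a` of the binary linear code spanned by a list of words, the words being
written as natural numbers. -/
def binarySpan : List ℕ → ℕ → List ℕ
  | [], a => [a]
  | r :: rs, a => binarySpan rs a ++ binarySpan rs (a ^^^ r)

theorem xor_mem_binarySpan {rs : List ℕ} {a b x y : ℕ} (hx : x ∈ binarySpan rs a)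
    (hy : y ∈ binarySpan rs b) : x ^^^ y ∈ binarySpan rs (a ^^^ b) := by
  induction rs generalizing a b with
  | nil => simp_all [binarySpan]
  | cons r rs ih =>
    simp only [binarySpan, List.mem_append] at hx hy ⊢
    rcases hx with hx | hx <;> rcases hy with hy | hy
    · exact .inl (ih hx hy)
    · exact .inr (by simpa only [Nat.xor_assoc] using ih hx hy)
    · refine .inr ?_
      have := ih hx hy
      rwa [Nat.xor_assoc, Nat.xor_comm r b, ← Nat.xor_assoc] at this
    · refine .inl ?_
      have := ih hx hy
      rwa [Nat.xor_assoc, Nat.xor_comm b r, ← Nat.xor_assoc r r b, Nat.xor_self, Nat.zero_xor]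
        at this

theorem mem_of_mem_binarySpan {C : Set ℕ} (hC : ∀ x ∈ C, ∀ y ∈ C, x ^^^ y ∈ C) {rs : List ℕ}
    {a x : ℕ} (hrs : ∀ r ∈ rs, r ∈ C) (ha : a ∈ C) (hx : x ∈ binarySpan rs a) : x ∈ C := by
  induction rs generalizing a with
  | nil => simp_all [binarySpan]
  | cons r rs ih =>
    simp only [binarySpan, List.mem_append] at hx
    have hrs' : ∀ r ∈ rs, r ∈ C := fun t ht => hrs t (List.mem_cons_of_mem _ ht)
    rcases hx with hx | hx
    · exact ih hrs' ha hx
    · exact ih hrs' (hC a ha r (hrs r List.mem_cons_self)) hx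

theorem length_binarySpan (rs : List ℕ) (a : ℕ) : (binarySpan rs a).length = 2 ^ rs.length := by
  induction rs generalizing a with
  | nil => rfl
  | cons r rs ih => rw [binarySpan, List.length_append, ih, ih, List.length_cons, pow_succ, mul_two]

theorem testBit_of_mem_binarySpan {rs : List ℕ} {n : ℕ} (hrs : ∀ r ∈ rs, r.testBit n = false)
    {a x : ℕ} (hx : x ∈ binarySpan rs a) : x.testBit n = a.testBit n := by
  induction rs generalizing a with
  | nil => simp_all [binarySpan]
  | cons r rs ih =>
    simp only [binarySpan, List.mem_append] at hx
    have hrs' : ∀ r ∈ rs, r.testBit n = false := fun t ht => hrs t (List.mem_cons_of_mem _ ht)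
    rcases hx with hx | hx
    · exact ih hrs' hx
    · rw [ih hrs' hx, Nat.testBit_xor, hrs r List.mem_cons_self, Bool.xor_false]

/-- A list of words in echelon form is linearly independent. -/
theorem nodup_binarySpan {rs : List ℕ} (h₁ : ∀ r ∈ rs, r.testBit r.log2 = true)
    (h₂ : rs.Pairwise fun r s => s.testBit r.log2 = false) (a : ℕ) : (binarySpan rs a).Nodup := by
  induction rs generalizing a with
  | nil => simp [binarySpan]
  | cons r rs ih =>
    rw [List.pairwise_cons] at h₂
    have h₁' : ∀ r ∈ rs, r.testBit r.log2 = true := fun t ht => h₁ t (List.mem_cons_of_mem _ ht)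
    rw [binarySpan, List.nodup_append']
    -- The two halves differ in the leading bit of `r`, which no later basis word changes.
    refine ⟨ih h₁' h₂.2 a, ih h₁' h₂.2 _, fun x hx hy => ?_⟩
    have hx' := testBit_of_mem_binarySpan h₂.1 hx
    have hy' := testBit_of_mem_binarySpan h₂.1 hy
    rw [hx', Nat.testBit_xor, h₁ r List.mem_cons_self] at hy'
    simp at hy'

/-- Reduction of `a` to `w` by the words of an echelon form. -/
def reducesTo : List ℕ → ℕ → ℕ → Bool
  | [], a, w => a == w
  | r :: rs, a, w => reducesTo rs (bif a.testBit r.log2 == w.testBit r.log2 then a else a ^^^ r) w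

theorem mem_binarySpan_of_reducesTo {rs : List ℕ} {a w : ℕ} (h : reducesTo rs a w = true) :
    w ∈ binarySpan rs a := by
  induction rs generalizing a with
  | nil =>
    rw [reducesTo, beq_iff_eq] at h
    simp [binarySpan, h]
  | cons r rs ih =>
    rw [reducesTo] at h
    rw [binarySpan, List.mem_append]
    cases hb : a.testBit r.log2 == w.testBit r.log2 <;> rw [hb] at h
    · exact .inr (ih h)
    · exact .inl (ih h)

/-- The number of words with the property `p` in a translate of a binary linear code. -/
def binarySpanCount (p : ℕ → Bool) : List ℕ → ℕ → ℕ
  | [], a => (p a).toNat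
  | r :: rs, a => binarySpanCount p rs a + binarySpanCount p rs (a ^^^ r)

theorem countP_binarySpan (p : ℕ → Bool) (rs : List ℕ) (a : ℕ) :
    (binarySpan rs a).countP p = binarySpanCount p rs a := by
  induction rs generalizing a with
  | nil => cases h : p a <;> simp [binarySpan, binarySpanCount, h]
  | cons r rs ih => rw [binarySpan, binarySpanCount, List.countP_append, ih, ih]

/-! ### The extended binary Golay code. -/

/-- A basis of the extended binary Golay code of length `24`, in echelon form. -/
def golayBasis : List ℕ :=
  [8391395, 4198290, 2099145, 1051766, 525883, 265359, 133589, 68472, 34236, 17118, 8559, 7973]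

/-- The words of the extended binary Golay code. -/
def golayWords : List ℕ := binarySpan golayBasis 0

theorem xor_mem_golayWords {x y : ℕ} (hx : x ∈ golayWords) (hy : y ∈ golayWords) :
    x ^^^ y ∈ golayWords := by
  have := xor_mem_binarySpan (a := 0) (b := 0) hx hy
  rwa [Nat.xor_self] at this

/-- The number of nonzero bits of `w` among the first `n`. -/
def bitWeight (w n : ℕ) : ℕ := Nat.rec 0 (fun k s => s + (w >>> k) % 2) n

/-- The positions of the nonzero bits of a word of length `24`. -/
def support (w : ℕ) : Finset (Fin 24) := {k | w.testBit k}

theorem mem_support {w : ℕ} {k : Fin 24} : k ∈ support w ↔ w.testBit k = true := by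
  simp [support]

theorem card_support (w : ℕ) : #(support w) = bitWeight w 24 := by
  have h : ∀ n, ∑ k ∈ range n, (w.testBit k).toNat = bitWeight w n := by
    intro n
    induction n with
    | zero => rfl
    | succ n ih =>
      rw [sum_range_succ, ih, Nat.toNat_testBit, ← Nat.shiftRight_eq_div_pow]
      rfl
  rw [← h, ← Fin.sum_univ_eq_sum_range (fun k => (w.testBit k).toNat), support, card_filter]
  refine sum_congr rfl fun k _ => ?_
  cases w.testBit k <;> rfl

theorem allOnes_mem_golayWords : 2 ^ 24 - 1 ∈ golayWords :=
  mem_binarySpan_of_reducesTo (by decide +kernel)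

theorem zero_mem_golayWords : 0 ∈ golayWords :=
  mem_binarySpan_of_reducesTo (by decide +kernel)

theorem golayWords_lt {w : ℕ} (hw : w ∈ golayWords) : w < 2 ^ 24 :=
  mem_of_mem_binarySpan (C := {x | x < 2 ^ 24}) (fun _ hx _ hy => Nat.xor_lt_two_pow hx hy)
    (by decide) (by norm_num) hw

theorem golayWords_nodup : golayWords.Nodup :=
  nodup_binarySpan (by decide +kernel) (by decide +kernel) 0

theorem length_golayWords : golayWords.length = 4096 :=
  length_binarySpan _ _

/-- A finite check: the words with an admissible weight are counted by the recursion
`binarySpanCount`, and the count is all 4096. -/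
theorem bitWeight_of_mem_golayWords {w : ℕ} (hw : w ∈ golayWords) :
    bitWeight w 24 = 0 ∨ 8 ≤ bitWeight w 24 ∧ 4 ∣ bitWeight w 24 := by
  have h : golayWords.countP (fun w => bitWeight w 24 == 0 ||
      (Nat.ble 8 (bitWeight w 24) && bitWeight w 24 % 4 == 0)) = golayWords.length := by
    rw [length_golayWords, golayWords, countP_binarySpan]
    decide +kernel
  have := List.countP_eq_length.1 h w hw
  simp only [Bool.or_eq_true, Bool.and_eq_true, beq_iff_eq, Nat.ble_eq] at this
  omega

theorem countP_octad_golayWords : golayWords.countP (fun w => bitWeight w 24 == 8) = 759 := by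
  rw [golayWords, countP_binarySpan]
  decide +kernel

/-- The `k`-th bit of `w`, as an integer. -/
def bit (w : ℕ) (k : Fin 24) : ℤ := if w.testBit k then 1 else 0

theorem bit_eq_zero_or_one (w : ℕ) (k : Fin 24) : bit w k = 0 ∨ bit w k = 1 := by
  unfold bit
  split_ifs <;> simp

theorem sum_bit (w : ℕ) : ∑ k, bit w k = bitWeight w 24 := by
  rw [← card_support, support, card_filter]
  push_cast
  rfl

theorem two_dvd_bit_xor (w u : ℕ) (k : Fin 24) : 2 ∣ bit w k - bit u k - bit (w ^^^ u) k := by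
  simp only [bit, Nat.testBit_xor]
  cases w.testBit k <;> cases u.testBit k <;> simp

theorem bit_allOnes (k : Fin 24) : bit (2 ^ 24 - 1) k = 1 := by
  rw [bit, Nat.testBit_two_pow_sub_one]
  simp

/-! ### The Leech lattice and its minimal norm. -/

/-- Membership in the Leech lattice, scaled so that the minimal squared norm is `32`. -/
def IsLeech (x : Fin 24 → ℤ) : Prop :=
  ∃ (m : ℤ) (y : Fin 24 → ℤ), ∃ w ∈ golayWords,
    (∀ k, x k = m + 2 * y k) ∧ (∀ k, 2 ∣ y k - bit w k) ∧ 8 ∣ ∑ k, x k - 4 * m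

theorem IsLeech.sub {x y : Fin 24 → ℤ} (hx : IsLeech x) (hy : IsLeech y) :
    IsLeech fun k => x k - y k := by
  obtain ⟨m, x', w, hw, hx, hxw, hxs⟩ := hx
  obtain ⟨n, y', u, hu, hy, hyu, hys⟩ := hy
  refine ⟨m - n, fun k => x' k - y' k, w ^^^ u, xor_mem_golayWords hw hu, fun k => ?_, fun k => ?_,
    ?_⟩
  · simp only [hx, hy]
    ring
  · have h1 := hxw k
    have h2 := hyu k
    have h3 := two_dvd_bit_xor w u k
    dsimp only
    omega
  · rw [sum_sub_distrib]
    omega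

/-- Shifting all coordinates by an integer keeps the parities of a Golay word in the code. -/
theorem exists_golayWord_add {w : ℕ} (hw : w ∈ golayWords) (n : ℤ) :
    ∃ u ∈ golayWords, ∀ k, 2 ∣ n + bit w k - bit u k := by
  rcases Int.even_or_odd n with ⟨r, hr⟩ | ⟨r, hr⟩
  · exact ⟨w, hw, fun k => by omega⟩
  · refine ⟨w ^^^ (2 ^ 24 - 1), xor_mem_golayWords hw allOnes_mem_golayWords, fun k => ?_⟩
    have h1 := two_dvd_bit_xor w (2 ^ 24 - 1) k
    have h2 := bit_allOnes k
    omega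

/-- The minimal squared norm of the Leech lattice is at least `32`. -/
theorem IsLeech.le_sum_sq {x : Fin 24 → ℤ} (hx : IsLeech x) (h0 : x ≠ 0) :
    32 ≤ ∑ k, x k * x k := by
  obtain ⟨m, y, w, hw, hx, hxw, hxs⟩ := hx
  obtain ⟨n, hn⟩ := Int.even_or_odd' m
  obtain ⟨u, hu, hun⟩ := exists_golayWord_add hw n
  have hY : ∀ k, 2 ∣ n + y k - bit u k := fun k => by
    have h1 := hxw k
    have h2 := hun k
    omega
  -- The parities of `n + y` form the Golay word `u`. For even `m` one has `x = 2 (n + y)`; for odd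
  -- `m` every coordinate of `x` is odd.
  rcases hn with hn | hn
  · have hx' : ∀ k, x k = 2 * (n + y k) := fun k => by rw [hx, hn]; ring
    -- If `u = 0` then `x = 4z`, and the sum condition makes `∑ z`, hence `∑ z²`, even and so at
    -- least 2. Otherwise at least 8 coordinates are nonzero and even, which gives 8 · 4 = 32.
    rcases bitWeight_of_mem_golayWords hu with h | ⟨h, -⟩
    · have hz : ∀ k, bit u k = 0 := by
        have := sum_bit u
        rw [h, Nat.cast_zero, sum_eq_zero_iff_of_nonneg] at this
        · exact fun k => this k (mem_univ k)
        · intro k _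
          rcases bit_eq_zero_or_one u k with h | h <;> omega
      have hZ : ∀ k, ∃ z, x k = 4 * z := fun k => by
        obtain ⟨z, h1⟩ := hY k
        have h2 := hz k
        exact ⟨z, by rw [hx']; omega⟩
      choose z hz using hZ
      obtain ⟨k, hk⟩ := Function.ne_iff.1 h0
      have hk' : z k ≠ 0 := fun h => hk (by rw [hz, h]; rfl)
      have hpos : 0 < ∑ k, z k * z k :=
        sum_pos' (fun k _ => mul_self_nonneg _) ⟨k, mem_univ k, mul_self_pos.2 hk'⟩
      have hpar : 2 ∣ ∑ k, z k * z k - ∑ k, z k := by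
        rw [← sum_sub_distrib]
        refine dvd_sum fun k _ => ?_
        have := Int.even_mul_pred_self (z k)
        rw [mul_sub, mul_one] at this
        exact this.two_dvd
      have hsum : ∑ k, x k = 4 * ∑ k, z k := by
        rw [mul_sum]
        exact sum_congr rfl fun k _ => hz k
      have hsq : ∑ k, x k * x k = 16 * ∑ k, z k * z k := by
        rw [mul_sum]
        exact sum_congr rfl fun k _ => by rw [hz]; ring
      omega
    · have hle : ∑ k, 4 * bit u k ≤ ∑ k, x k * x k := by
        refine sum_le_sum fun k _ => ?_
        rw [hx']
        have h1 := hY k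
        rcases bit_eq_zero_or_one u k with h | h
        · rw [h]
          nlinarith [mul_self_nonneg (n + y k)]
        · have h2 : n + y k ≠ 0 := by omega
          have := mul_self_pos.2 h2
          rw [h]
          nlinarith
      rw [← mul_sum, sum_bit] at hle
      omega
  · have hx' : ∀ k, x k = 1 + 2 * (n + y k) := fun k => by rw [hx, hn]; ring
    have hsq : ∀ k, x k * x k = 1 + 4 * ((n + y k) * (n + y k + 1)) := fun k => by rw [hx']; ring
    have hev : ∀ k, 2 ∣ (n + y k) * (n + y k + 1) := fun k =>
      (Int.even_mul_succ_self (n + y k)).two_dvd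
    -- Odd squares are 1 modulo 8, so a squared norm below 32 must be 24 with all entries `±1`. Then
    -- `∑ x = 24 - 2 wt(u)` is divisible by 8, whereas `∑ x ≡ 4m ≡ 4` modulo 8.
    have hdvd : 8 ∣ ∑ k, x k * x k - 24 := by
      have : (24 : ℤ) = ∑ _k : Fin 24, 1 := by simp
      rw [this, ← sum_sub_distrib]
      refine dvd_sum fun k _ => ?_
      have h1 := hsq k
      have h2 := hev k
      omega
    by_contra! hlt
    have hone : ∀ k, 1 ≤ x k * x k := fun k => by
      have : x k ≠ 0 := by rw [hx']; omega
      have := mul_self_pos.2 this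
      omega
    have hall : ∀ k, x k * x k = 1 := by
      by_contra! hne
      obtain ⟨k, hk⟩ := hne
      have : ∑ _k : Fin 24, (1 : ℤ) < ∑ k, x k * x k :=
        sum_lt_sum (fun k _ => hone k) ⟨k, mem_univ k, lt_of_le_of_ne (hone k) (Ne.symm hk)⟩
      simp only [sum_const, card_univ, Fintype.card_fin, nsmul_eq_mul, Nat.cast_ofNat] at this
      omega
    have hval : ∀ k, x k = 1 - 2 * bit u k := fun k => by
      have h1 := hY k
      have h2 := hx' k
      rcases mul_self_eq_one_iff.1 (hall k) with h | h <;>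
      rcases bit_eq_zero_or_one u k with h3 | h3 <;> omega
    have hsum : ∑ k, x k = 24 - 2 * bitWeight u 24 := by
      rw [sum_congr rfl fun k _ => hval k, sum_sub_distrib, ← mul_sum, sum_bit]
      simp
    have : 4 ∣ bitWeight u 24 := by
      rcases bitWeight_of_mem_golayWords hu with h | h
      · simp [h]
      · exact h.2
    omega

/-- The difference is a nonzero lattice vector, so `64 - 2 ⟨x, y⟩ ≥ 32`. -/
theorem IsLeech.sum_mul_le {x y : Fin 24 → ℤ} (hx : IsLeech x) (hy : IsLeech y)
    (hx32 : ∑ k, x k * x k = 32) (hy32 : ∑ k, y k * y k = 32) (hxy : x ≠ y) :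
    ∑ k, x k * y k ≤ 16 := by
  have h := (hx.sub hy).le_sum_sq fun h => hxy (funext fun k => sub_eq_zero.1 (congrFun h k))
  have : ∑ k, (x k - y k) * (x k - y k)
      = ∑ k, x k * x k + ∑ k, y k * y k - 2 * ∑ k, x k * y k := by
    rw [mul_sum, ← sum_add_distrib, ← sum_sub_distrib]
    exact sum_congr rfl fun k _ => by ring
  omega

/-! ### The minimal vectors of the Leech lattice. -/

/-- The vector with entries `-a` on `s`, `a` on the rest of `t`, and `0` elsewhere. -/
def signedVec (a : ℤ) (p : Σ _ : Finset (Fin 24), Finset (Fin 24)) (k : Fin 24) : ℤ :=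
  if k ∈ p.2 then -a else if k ∈ p.1 then a else 0

theorem sum_signedVec {a : ℤ} {t s : Finset (Fin 24)} (h : s ⊆ t) :
    ∑ k, signedVec a ⟨t, s⟩ k = a * (#t - 2 * #s) := by
  have : ∀ k, signedVec a ⟨t, s⟩ k = (if k ∈ t then a else 0) - 2 * (if k ∈ s then a else 0) := by
    intro k
    have := @h k
    by_cases h1 : k ∈ s <;> by_cases h2 : k ∈ t <;> simp_all [signedVec]
    ring
  rw [sum_congr rfl fun k _ => this k, sum_sub_distrib, ← mul_sum, sum_ite_mem, sum_ite_mem]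
  simp
  ring

theorem sum_signedVec_mul_self {a : ℤ} {t s : Finset (Fin 24)} (h : s ⊆ t) :
    ∑ k, signedVec a ⟨t, s⟩ k * signedVec a ⟨t, s⟩ k = a * a * #t := by
  have : ∀ k, signedVec a ⟨t, s⟩ k * signedVec a ⟨t, s⟩ k = if k ∈ t then a * a else 0 := by
    intro k
    have := @h k
    by_cases h1 : k ∈ s <;> by_cases h2 : k ∈ t <;> simp_all [signedVec]
  rw [sum_congr rfl fun k _ => this k, sum_ite_mem]
  simp
  ring

theorem signedVec_injOn {a : ℤ} (ha : 0 < a) :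
    Set.InjOn (signedVec a) {p | p.2 ⊆ p.1} := by
  rintro ⟨t, s⟩ h ⟨t', s'⟩ h' heq
  have hk : ∀ k, (k ∈ t ↔ k ∈ t') ∧ (k ∈ s ↔ k ∈ s') := by
    intro k
    have h1 : k ∈ s → k ∈ t := @h k
    have h2 : k ∈ s' → k ∈ t' := @h' k
    have h3 := congrFun heq k
    simp only [signedVec] at h3
    split_ifs at h3 <;> first | omega | tauto
  obtain rfl : t = t' := Finset.ext fun k => (hk k).1
  obtain rfl : s = s' := Finset.ext fun k => (hk k).2
  rfl

/-- The vector `(∓3, ±1²³)` with signs given by the word `w` and the exceptional coordinate `i`. -/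
def spinVec (p : ℕ × Fin 24) (k : Fin 24) : ℤ :=
  (1 - 2 * bit p.1 k) * if k = p.2 then -3 else 1

theorem spinVec_eq (w : ℕ) (i k : Fin 24) :
    spinVec (w, i) k = 1 - 2 * bit w k - 4 * (if k = i then 1 - 2 * bit w i else 0) := by
  simp only [spinVec]
  split_ifs with h
  · rw [h]
    ring
  · ring

theorem sum_spinVec (w : ℕ) (i : Fin 24) :
    ∑ k, spinVec (w, i) k = 24 - 2 * bitWeight w 24 - 4 * (1 - 2 * bit w i) := by
  simp only [spinVec_eq, sum_sub_distrib, ← mul_sum, sum_bit, sum_ite_eq', mem_univ, if_true]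
  simp

theorem sum_spinVec_mul_self (p : ℕ × Fin 24) : ∑ k, spinVec p k * spinVec p k = 32 := by
  have : ∀ k, spinVec p k * spinVec p k = 1 + if k = p.2 then 8 else 0 := by
    intro k
    simp only [spinVec]
    rcases bit_eq_zero_or_one p.1 k with h | h <;> split_ifs <;> rw [h] <;> norm_num
  rw [sum_congr rfl fun k _ => this k, sum_add_distrib, sum_ite_eq' univ p.2]
  simp

theorem spinVec_injOn : Set.InjOn spinVec {p | p.1 < 2 ^ 24} := by
  rintro ⟨w, i⟩ hw ⟨u, j⟩ hu heq
  have hk : ∀ k, bit w k = bit u k ∧ (k = i ↔ k = j) := by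
    intro k
    have h := congrFun heq k
    simp only [spinVec] at h
    rcases bit_eq_zero_or_one w k with h1 | h1 <;> rcases bit_eq_zero_or_one u k with h2 | h2 <;>
    rw [h1, h2] at h ⊢ <;> split_ifs at h <;> simp_all
  refine Prod.ext (Nat.eq_of_testBit_eq fun n => ?_) ((hk i).2.1 rfl)
  by_cases hn : n < 24
  · have := (hk ⟨n, hn⟩).1
    simp only [bit] at this
    cases h1 : w.testBit n <;> cases h2 : u.testBit n <;> simp_all
  · have h24 : 2 ^ 24 ≤ 2 ^ n := Nat.pow_le_pow_right (by norm_num) (by omega)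
    rw [Nat.testBit_lt_two_pow (lt_of_lt_of_le hw h24),
      Nat.testBit_lt_two_pow (lt_of_lt_of_le hu h24)]

/-- The alternating sum over the subsets of a nonempty set vanishes. For an octad this leaves 128
admissible sign patterns. -/
theorem card_filter_even_powerset {α : Type*} {t : Finset α} (ht : t.Nonempty) :
    2 * #(t.powerset.filter fun s => Even #s) = 2 ^ #t := by
  have h := sum_powerset_neg_one_pow_card_of_nonempty ht
  rw [← sum_filter_add_sum_filter_not _ (fun s => Even #s),
    sum_congr rfl (fun s hs => (mem_filter.1 hs).2.neg_one_pow),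
    sum_congr rfl (fun s hs => (Nat.not_even_iff_odd.1 (mem_filter.1 hs).2).neg_one_pow)] at h
  simp only [sum_const, nsmul_eq_mul, mul_one, mul_neg] at h
  have h' := card_filter_add_card_filter_not (s := t.powerset) (fun s => Even #s)
  rw [card_powerset] at h'
  omega

/-- The octads of the Golay code. -/
def octads : Finset (Finset (Fin 24)) :=
  (golayWords.filter fun w => bitWeight w 24 == 8).toFinset.image support

theorem support_injOn : Set.InjOn support {w | w < 2 ^ 24} := by
  intro w hw u hu heq
  refine Nat.eq_of_testBit_eq fun n => ?_
  by_cases hn : n < 24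
  · have : (⟨n, hn⟩ : Fin 24) ∈ support w ↔ ⟨n, hn⟩ ∈ support u := by rw [heq]
    rw [mem_support, mem_support] at this
    exact Bool.eq_iff_iff.2 this
  · have h24 : 2 ^ 24 ≤ 2 ^ n := Nat.pow_le_pow_right (by norm_num) (by omega)
    rw [Nat.testBit_lt_two_pow (lt_of_lt_of_le hw h24),
      Nat.testBit_lt_two_pow (lt_of_lt_of_le hu h24)]

theorem card_octads : #octads = 759 := by
  rw [octads, card_image_of_injOn, List.toFinset_card_of_nodup (golayWords_nodup.filter _),
    ← List.countP_eq_length_filter, countP_octad_golayWords]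
  intro w hw u hu
  simp only [List.coe_toFinset, List.mem_filter, Set.mem_ofPred_eq] at hw hu
  exact support_injOn (golayWords_lt hw.1) (golayWords_lt hu.1)

theorem exists_of_mem_octads {t : Finset (Fin 24)} (ht : t ∈ octads) :
    #t = 8 ∧ ∃ w ∈ golayWords, support w = t := by
  rw [octads, mem_image] at ht
  obtain ⟨w, hw, rfl⟩ := ht
  rw [List.mem_toFinset, List.mem_filter, beq_iff_eq] at hw
  exact ⟨by rw [card_support, hw.2], w, hw.1, rfl⟩

/-- The minimal vectors of shape `(±4², 0²²)`. -/
def leechFours : Finset (Fin 24 → ℤ) :=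
  ((powersetCard 2 univ).sigma fun t => t.powerset).image (signedVec 4)

/-- The minimal vectors of shape `(±2⁸, 0¹⁶)`. -/
def leechTwos : Finset (Fin 24 → ℤ) :=
  (octads.sigma fun t => t.powerset.filter fun s => Even #s).image (signedVec 2)

/-- The minimal vectors of shape `(∓3, ±1²³)`. -/
def leechOdds : Finset (Fin 24 → ℤ) :=
  (golayWords.toFinset ×ˢ univ).image spinVec

/-- The minimal vectors of the Leech lattice. -/
def leechMin : Finset (Fin 24 → ℤ) := leechFours ∪ leechTwos ∪ leechOdds

attribute [irreducible] leechFours leechTwos leechOdds leechMin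

theorem card_leechFours : #leechFours = 1104 := by
  rw [leechFours, card_image_of_injOn, card_sigma]
  · rw [sum_congr rfl fun t ht => by
      rw [card_powerset, (mem_powersetCard.1 ht).2], sum_const, card_powersetCard]
    simp [Nat.choose]
  · refine (signedVec_injOn (by norm_num)).mono fun p hp => ?_
    rw [mem_coe, mem_sigma] at hp
    exact mem_powerset.1 hp.2

theorem card_leechTwos : #leechTwos = 97152 := by
  rw [leechTwos, card_image_of_injOn, card_sigma]
  · rw [sum_congr rfl (g := fun _ => 128) fun t ht => by
      have h8 := (exists_of_mem_octads ht).1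
      have := card_filter_even_powerset (card_pos.1 (by omega : 0 < #t))
      rw [h8] at this
      omega, sum_const, card_octads]
    norm_num
  · refine (signedVec_injOn (by norm_num)).mono fun p hp => ?_
    rw [mem_coe, mem_sigma, mem_filter] at hp
    exact mem_powerset.1 hp.2.1

theorem card_leechOdds : #leechOdds = 98304 := by
  rw [leechOdds, card_image_of_injOn, card_product, List.toFinset_card_of_nodup golayWords_nodup,
    length_golayWords]
  · simp
  · refine spinVec_injOn.mono fun p hp => ?_
    rw [mem_coe, mem_product, List.mem_toFinset] at hp
    exact golayWords_lt hp.1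

theorem isLeech_of_mem_leechFours {x : Fin 24 → ℤ} (hx : x ∈ leechFours) :
    IsLeech x ∧ ∑ k, x k * x k = 32 := by
  rw [leechFours, mem_image] at hx
  obtain ⟨⟨t, s⟩, hp, rfl⟩ := hx
  simp only [mem_sigma, mem_powersetCard, mem_powerset] at hp
  refine ⟨⟨0, fun k => signedVec 4 ⟨t, s⟩ k / 2, 0, zero_mem_golayWords, fun k => ?_, fun k => ?_,
    ?_⟩, ?_⟩
  · simp only [signedVec]
    split_ifs <;> norm_num
  · have : bit 0 k = 0 := by simp [bit]
    simp only [signedVec, this]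
    split_ifs <;> norm_num
  · rw [sum_signedVec hp.2, hp.1.2]
    push_cast
    omega
  · rw [sum_signedVec_mul_self hp.2, hp.1.2]
    norm_num

theorem isLeech_of_mem_leechTwos {x : Fin 24 → ℤ} (hx : x ∈ leechTwos) :
    IsLeech x ∧ ∑ k, x k * x k = 32 := by
  rw [leechTwos, mem_image] at hx
  obtain ⟨⟨t, s⟩, hp, rfl⟩ := hx
  simp only [mem_sigma, mem_filter, mem_powerset] at hp
  obtain ⟨ht, hst, heven⟩ := hp
  obtain ⟨h8, w, hw, rfl⟩ := exists_of_mem_octads ht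
  refine ⟨⟨0, fun k => signedVec 2 ⟨support w, s⟩ k / 2, w, hw, fun k => ?_, fun k => ?_, ?_⟩, ?_⟩
  · simp only [signedVec]
    split_ifs <;> norm_num
  · have h1 : k ∈ s → w.testBit k = true := fun h => mem_support.1 (hst h)
    simp only [signedVec, bit, mem_support]
    split_ifs <;> simp_all
  · rw [sum_signedVec hst, h8]
    obtain ⟨r, hr⟩ := heven
    push_cast
    omega
  · rw [sum_signedVec_mul_self hst, h8]
    norm_num

theorem isLeech_spinVec {w : ℕ} (hw : w ∈ golayWords) (i : Fin 24) : IsLeech (spinVec (w, i)) := by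
  refine ⟨1, fun k => -bit w k - 2 * (if k = i then 1 - 2 * bit w i else 0), w, hw, fun k => ?_,
    fun k => ?_, ?_⟩
  · rw [spinVec_eq]
    ring
  · dsimp only
    omega
  · rw [sum_spinVec]
    have h4 : 4 ∣ bitWeight w 24 := by
      rcases bitWeight_of_mem_golayWords hw with h | h
      · simp [h]
      · exact h.2
    omega

theorem isLeech_of_mem_leechOdds {x : Fin 24 → ℤ} (hx : x ∈ leechOdds) :
    IsLeech x ∧ ∑ k, x k * x k = 32 := by
  rw [leechOdds, mem_image] at hx
  obtain ⟨⟨w, i⟩, hp, rfl⟩ := hx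
  rw [mem_product, List.mem_toFinset] at hp
  exact ⟨isLeech_spinVec hp.1 i, sum_spinVec_mul_self _⟩

theorem isLeech_of_mem_leechMin {x : Fin 24 → ℤ} (hx : x ∈ leechMin) :
    IsLeech x ∧ ∑ k, x k * x k = 32 := by
  rw [leechMin, mem_union, mem_union] at hx
  rcases hx with (hx | hx) | hx
  · exact isLeech_of_mem_leechFours hx
  · exact isLeech_of_mem_leechTwos hx
  · exact isLeech_of_mem_leechOdds hx

/-- Residues separate the three shapes: all entries 0 modulo 4, all even with some entry 2 modulo 4,
all odd. The total is 1104 + 97152 + 98304. -/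
theorem card_leechMin : #leechMin = 196560 := by
  have hfour : ∀ x ∈ leechFours, ∀ k, x k % 4 = 0 := by
    intro x hx k
    rw [leechFours, mem_image] at hx
    obtain ⟨p, -, rfl⟩ := hx
    simp only [signedVec]
    split_ifs <;> norm_num
  have htwo : ∀ x ∈ leechTwos, (∀ k, x k % 2 = 0) ∧ ∃ k, x k % 4 = 2 := by
    intro x hx
    rw [leechTwos, mem_image] at hx
    obtain ⟨⟨t, s⟩, hp, rfl⟩ := hx
    rw [mem_sigma] at hp
    dsimp only at hp
    constructor
    · intro k
      simp only [signedVec]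
      split_ifs <;> norm_num
    · have h8 := (exists_of_mem_octads hp.1).1
      obtain ⟨k, hk⟩ := card_pos.1 (by omega : 0 < #t)
      refine ⟨k, ?_⟩
      simp only [signedVec, if_pos hk]
      split_ifs <;> norm_num
  have hodd : ∀ x ∈ leechOdds, ∀ k, x k % 2 = 1 := by
    intro x hx k
    rw [leechOdds, mem_image] at hx
    obtain ⟨⟨w, i⟩, -, rfl⟩ := hx
    rw [spinVec_eq]
    omega
  rw [leechMin, card_union_of_disjoint, card_union_of_disjoint, card_leechFours, card_leechTwos,
    card_leechOdds]
  · refine disjoint_left.2 fun x h4 h2 => ?_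
    obtain ⟨k, hk⟩ := (htwo x h2).2
    have := hfour x h4 k
    omega
  · refine disjoint_left.2 fun x h h1 => ?_
    have h1 := hodd x h1 0
    rcases mem_union.1 h with h | h
    · have := hfour x h 0
      omega
    · have := (htwo x h).1 0
      omega

theorem sum_mul_le_of_mem_leechMin {x y : Fin 24 → ℤ} (hx : x ∈ leechMin) (hy : y ∈ leechMin)
    (hxy : x ≠ y) : ∑ k, x k * y k ≤ 16 :=
  (isLeech_of_mem_leechMin hx).1.sum_mul_le (isLeech_of_mem_leechMin hy).1
    (isLeech_of_mem_leechMin hx).2 (isLeech_of_mem_leechMin hy).2 hxy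

/-! ### Disjoint layers of minimal vectors. -/

/-- A basis, in echelon form, of a subcode of the Golay code without words of weight `8`. -/
def layerBasis : List ℕ := [8975856, 4967526, 2256301, 1108603, 521994]

/-- A basis, in echelon form, of a subcode that meets the span of `layerBasis` trivially. -/
def translationBasis : List ℕ := [133589, 68472, 34236, 17118, 8559, 7973]

/-- The coordinates outside an octad. -/
def layerPositions : List (Fin 24) := [1, 3, 4, 5, 7, 10, 11, 12, 13, 15, 17, 18, 19, 20, 21, 22]

/-- For each coordinate of `layerPositions`, the coset of the span of `layerBasis` used there. -/
def layerRep (i : Fin 24) : ℕ :=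
  [0, 0, 0, 247247, 175366, 727987, 0, 127568, 0, 0, 676373, 525883, 636597, 7973, 0, 255136, 0,
    110734, 747303, 684922, 633232, 541925, 184722, 0].getD i 0

/-- The translate by the word `t` of a set of `512` minimal vectors of the Leech lattice with
pairwise inner products at most `8`. -/
def layerAt (t : ℕ) : Finset (Fin 24 → ℤ) :=
  (layerPositions.toFinset.sigma fun i =>
    (binarySpan layerBasis (layerRep i ^^^ t)).toFinset).image fun p => spinVec (p.2, p.1)

theorem mem_layerAt {t : ℕ} {x : Fin 24 → ℤ} : x ∈ layerAt t ↔ ∃ i ∈ layerPositions,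
    ∃ w ∈ binarySpan layerBasis (layerRep i ^^^ t), spinVec (w, i) = x := by
  simp only [layerAt, mem_image, mem_sigma, List.mem_toFinset, Sigma.exists]
  constructor
  · rintro ⟨i, w, ⟨hi, hw⟩, h⟩
    exact ⟨i, hi, w, hw, h⟩
  · rintro ⟨i, hi, w, hw, h⟩
    exact ⟨i, w, ⟨hi, hw⟩, h⟩

theorem layerBasis_subset : ∀ r ∈ layerBasis, r ∈ golayWords := by
  intro r hr
  refine mem_binarySpan_of_reducesTo ?_
  revert r
  decide +kernel

theorem translationBasis_subset : ∀ r ∈ translationBasis, r ∈ golayWords := by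
  intro r hr
  refine mem_binarySpan_of_reducesTo ?_
  revert r
  decide +kernel

theorem mem_golayWords_of_mem_translations {t : ℕ} (ht : t ∈ binarySpan translationBasis 0) :
    t ∈ golayWords :=
  mem_of_mem_binarySpan (C := {w | w ∈ golayWords}) (fun _ hx _ hy => xor_mem_golayWords hx hy)
    translationBasis_subset zero_mem_golayWords ht

theorem layerRep_mem (i : Fin 24) : layerRep i ∈ golayWords := by
  refine mem_binarySpan_of_reducesTo ?_
  revert i
  decide +kernel

theorem mem_golayWords_of_mem_layer {i : Fin 24} {t w : ℕ} (ht : t ∈ golayWords)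
    (hw : w ∈ binarySpan layerBasis (layerRep i ^^^ t)) : w ∈ golayWords :=
  mem_of_mem_binarySpan (C := {w | w ∈ golayWords}) (fun _ hx _ hy => xor_mem_golayWords hx hy)
    layerBasis_subset (xor_mem_golayWords (layerRep_mem i) ht) hw

theorem layerAt_subset {t : ℕ} (ht : t ∈ golayWords) : layerAt t ⊆ leechMin := by
  intro x hx
  obtain ⟨i, -, w, hw, rfl⟩ := mem_layerAt.1 hx
  rw [leechMin, mem_union, leechOdds, mem_image]
  refine .inr ⟨(w, i), ?_, rfl⟩
  rw [mem_product, List.mem_toFinset]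
  exact ⟨mem_golayWords_of_mem_layer ht hw, mem_univ i⟩

theorem card_layerAt {t : ℕ} (ht : t ∈ golayWords) : #(layerAt t) = 512 := by
  rw [layerAt, card_image_of_injOn, card_sigma]
  · have h : ∀ a, #(binarySpan layerBasis a).toFinset = 32 := fun a => by
      rw [List.toFinset_card_of_nodup
        (nodup_binarySpan (by decide +kernel) (by decide +kernel) a), length_binarySpan]
      rfl
    simp only [h, sum_const]
    rw [List.toFinset_card_of_nodup (by decide)]
    rfl
  · rintro ⟨i, w⟩ hp ⟨j, u⟩ hq h
    rw [mem_coe, mem_sigma, List.mem_toFinset] at hp hq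
    have := spinVec_injOn
      (golayWords_lt (mem_golayWords_of_mem_layer ht (List.mem_toFinset.1 hp.2)))
      (golayWords_lt (mem_golayWords_of_mem_layer ht (List.mem_toFinset.1 hq.2))) h
    obtain ⟨rfl, rfl⟩ := Prod.mk.inj this
    rfl

/-- Only `w ^^^ u` enters, so translating all sign words by a common `t` preserves inner products.
The bound 8 becomes a condition on the weight of `w ^^^ u` and its bits at `i` and `j`. -/
theorem sum_spinVec_mul (w u : ℕ) (i j : Fin 24) :
    ∑ k, spinVec (w, i) k * spinVec (u, j) k = 24 - 2 * (bitWeight (w ^^^ u) 24 : ℤ)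
      - 4 * (1 - 2 * bit (w ^^^ u) i) - 4 * (1 - 2 * bit (w ^^^ u) j)
      + if i = j then 16 * (1 - 2 * bit (w ^^^ u) i) else 0 := by
  have hxor : ∀ k, (1 - 2 * bit w k) * (1 - 2 * bit u k) = 1 - 2 * bit (w ^^^ u) k := by
    intro k
    simp only [bit, Nat.testBit_xor]
    cases w.testBit k <;> cases u.testBit k <;> simp
  have h : ∀ k, spinVec (w, i) k * spinVec (u, j) k = 1 - 2 * bit (w ^^^ u) k
      - 4 * (if k = i then 1 - 2 * bit (w ^^^ u) i else 0)
      - 4 * (if k = j then 1 - 2 * bit (w ^^^ u) j else 0)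
      + if k = i then if i = j then 16 * (1 - 2 * bit (w ^^^ u) i) else 0 else 0 := by
    intro k
    simp only [spinVec]
    rw [mul_mul_mul_comm, hxor]
    split_ifs <;> first | (subst_vars; ring1) | (exfalso; simp_all)
  rw [sum_congr rfl fun k _ => h k]
  simp only [sum_add_distrib, sum_sub_distrib, ← mul_sum, sum_bit, sum_ite_eq', mem_univ, if_true]
  simp

theorem le_bitWeight_of_mem_layerBasis :
    ∀ w ∈ binarySpan layerBasis 0, w = 0 ∨ 12 ≤ bitWeight w 24 := by
  decide +kernel

/-- For `i ≠ j` the inner product is `16 - 2 wt + 8 (bᵢ + bⱼ)`, and this inequality says exactly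
that it is at most 8. The coset representatives `layerRep` are such that it holds for every pair of
positions. -/
theorem layerPositions_pairwise : layerPositions.Pairwise fun i j =>
    ∀ w ∈ binarySpan layerBasis (layerRep i ^^^ layerRep j),
      4 + 4 * ((w >>> i.val) % 2 + (w >>> j.val) % 2) ≤ bitWeight w 24 := by
  decide +kernel

theorem cast_shiftRight_mod_two (w : ℕ) (k : Fin 24) : (((w >>> k.val) % 2 : ℕ) : ℤ) = bit w k := by
  rw [Nat.shiftRight_eq_div_pow, ← Nat.toNat_testBit, bit]
  cases w.testBit k <;> rfl

theorem le_bitWeight_of_ne {i j : Fin 24} (hi : i ∈ layerPositions) (hj : j ∈ layerPositions)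
    (hij : i ≠ j) {w : ℕ} (hw : w ∈ binarySpan layerBasis (layerRep i ^^^ layerRep j)) :
    4 + 4 * (bit w i + bit w j) ≤ bitWeight w 24 := by
  let R : Fin 24 → Fin 24 → Prop := fun i j =>
    ∀ w ∈ binarySpan layerBasis (layerRep i ^^^ layerRep j),
      4 + 4 * ((w >>> i.val) % 2 + (w >>> j.val) % 2) ≤ bitWeight w 24
  have : Std.Symm R := ⟨fun i j h w hw => by
    rw [Nat.xor_comm] at hw
    rw [add_comm (_ % 2)]
    exact h w hw⟩
  have h := List.Pairwise.forall (R := R) layerPositions_pairwise hi hj hij w hw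
  rw [← cast_shiftRight_mod_two, ← cast_shiftRight_mod_two]
  exact_mod_cast h

theorem sum_mul_le_of_mem_layerAt {t : ℕ} {x y : Fin 24 → ℤ} (hx : x ∈ layerAt t)
    (hy : y ∈ layerAt t) (hxy : x ≠ y) : ∑ k, x k * y k ≤ 8 := by
  obtain ⟨i, hi, w, hw, rfl⟩ := mem_layerAt.1 hx
  obtain ⟨j, hj, u, hu, rfl⟩ := mem_layerAt.1 hy
  have h := xor_mem_binarySpan hw hu
  have ht : layerRep i ^^^ t ^^^ (layerRep j ^^^ t) = layerRep i ^^^ layerRep j := by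
    rw [Nat.xor_comm (layerRep j), ← Nat.xor_assoc, Nat.xor_assoc (layerRep i) t t, Nat.xor_self,
      Nat.xor_zero]
  rw [ht] at h
  rw [sum_spinVec_mul]
  split_ifs with hij
  · subst hij
    rw [Nat.xor_self] at h
    rcases le_bitWeight_of_mem_layerBasis _ h with h0 | h
    · exact absurd (by rw [Nat.xor_eq_zero_iff.1 h0]) hxy
    -- With equal positions the inner product is `24 - 2 wt ± 8`, hence at most 8 once the weight is
    -- at least 12.
    · rcases bit_eq_zero_or_one (w ^^^ u) i with h' | h' <;> omega
  · have := le_bitWeight_of_ne hi hj hij h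
    omega

theorem disjoint_layerAt {t t' : ℕ} (ht : t ∈ binarySpan translationBasis 0)
    (ht' : t' ∈ binarySpan translationBasis 0) (htt' : t ≠ t') :
    Disjoint (layerAt t) (layerAt t') := by
  -- The translation code meets the span of `layerBasis` only in 0. A vector common to both layers
  -- has a sign word in two cosets of that span, which would put `t ^^^ t'` in it.
  have hT : ∀ t ∈ binarySpan translationBasis 0, t = 0 ∨ 0 ∉ binarySpan layerBasis t := by
    decide +kernel
  refine disjoint_left.2 fun x hx hx' => ?_
  obtain ⟨i, -, w, hw, rfl⟩ := mem_layerAt.1 hx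
  obtain ⟨j, -, u, hu, h⟩ := mem_layerAt.1 hx'
  have := spinVec_injOn
    (golayWords_lt (mem_golayWords_of_mem_layer (mem_golayWords_of_mem_translations ht') hu))
    (golayWords_lt (mem_golayWords_of_mem_layer (mem_golayWords_of_mem_translations ht) hw)) h
  obtain ⟨rfl, rfl⟩ := Prod.mk.inj this
  have h0 := xor_mem_binarySpan hw hu
  have hx : layerRep j ^^^ t ^^^ (layerRep j ^^^ t') = t ^^^ t' := by
    rw [Nat.xor_comm (layerRep j) t, Nat.xor_assoc, ← Nat.xor_assoc (layerRep j), Nat.xor_self,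
      Nat.zero_xor]
  rw [Nat.xor_self, hx] at h0
  rcases hT _ (xor_mem_binarySpan ht ht') with h | h
  · exact htt' (Nat.xor_eq_zero_iff.1 h)
  · exact h h0

/-- The layer number `j`. -/
def layer (j : ℕ) : Finset (Fin 24 → ℤ) := layerAt ((binarySpan translationBasis 0).getD j 0)

theorem getD_mem_translations {j : ℕ} (hj : j < 64) :
    (binarySpan translationBasis 0).getD j 0 ∈ binarySpan translationBasis 0 := by
  have hj' : j < (binarySpan translationBasis 0).length := by
    rw [length_binarySpan]
    exact hj
  rw [List.getD_eq_getElem _ _ hj']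
  exact List.getElem_mem hj'

theorem getD_translations_inj {i j : ℕ} (hi : i < 64) (hj : j < 64)
    (h : (binarySpan translationBasis 0).getD i 0 = (binarySpan translationBasis 0).getD j 0) :
    i = j := by
  have hlen : (binarySpan translationBasis 0).length = 64 := length_binarySpan _ _
  rw [List.getD_eq_getElem _ _ (hlen ▸ hi), List.getD_eq_getElem _ _ (hlen ▸ hj)] at h
  exact (List.Nodup.getElem_inj_iff
    (nodup_binarySpan (by decide +kernel) (by decide +kernel) 0)).1 h

/-- A labelled code with at most `64` labels gives a kissing configuration. -/
theorem le_kissingNumber_of_labelledCode {c : List ℕ} {N : ℕ} (hN : 0 < N)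
    {P : List (ℕ × List ℤ)} (hP : IsLabelledCode c N P) {l : ℕ} (hl : ∀ p ∈ P, p.1 < l)
    (h64 : l ≤ 64) :
    ((196560 - l * 512 + P.length * 512 : ℕ) : ℕ∞) ≤ kissingNumber (24 + c.length) := by
  have hG : ∀ j < l, (binarySpan translationBasis 0).getD j 0 ∈ golayWords := fun j hj =>
    mem_golayWords_of_mem_translations (getD_mem_translations (hj.trans_le h64))
  rw [← card_leechMin]
  exact le_kissingNumber_of_layers leechMin layer l
    (fun x hx => (isLeech_of_mem_leechMin hx).2)
    (fun x hx y hy hxy => sum_mul_le_of_mem_leechMin hx hy hxy)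
    (fun j hj => layerAt_subset (hG j hj))
    (fun j hj => card_layerAt (hG j hj))
    (fun i hi j hj hij => disjoint_layerAt (getD_mem_translations (hi.trans_le h64))
      (getD_mem_translations (hj.trans_le h64))
      fun h => hij (getD_translations_inj (hi.trans_le h64) (hj.trans_le h64) h))
    (fun j hj x hx y hy hxy => sum_mul_le_of_mem_layerAt hx hy hxy)
    hN hP hl

/-! ### Triangles in root systems. -/

/-- The vertices of a list of equilateral triangles centred at the origin, each given by two of
its vertices, labelled by the position of the triangle in the list. -/
def labelledVertices (T : List (List ℤ × List ℤ)) : List (ℕ × List ℤ) :=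
  T.zipIdx.flatMap fun t =>
    [(t.2, t.1.1), (t.2, t.1.2), (t.2, List.zipWith (fun x y => -x - y) t.1.1 t.1.2)]

/-- The roots of `A₂`, for the form `x² + 3y²`, as two triangles. -/
def triangles₂ : List (List ℤ × List ℤ) :=
  [([2, 0], [-1, 1]), ([-2, 0], [1, -1])]

/-- The roots of `D₃` as four triangles. -/
def triangles₃ : List (List ℤ × List ℤ) :=
  [([1, -1, 0], [0, 1, 1]), ([1, 1, 0], [0, -1, -1]), ([1, 0, 1], [0, 1, -1]),
   ([1, 0, -1], [0, -1, 1])]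

/-- The roots of `D₄` as eight triangles. -/
def triangles₄ : List (List ℤ × List ℤ) :=
  [([1, 1, 0, 0], [0, -1, 0, -1]), ([0, 1, 0, -1], [0, 0, -1, 1]),
   ([1, 0, 1, 0], [0, -1, -1, 0]), ([0, 1, 1, 0], [0, 0, -1, -1]),
   ([1, 0, 0, 1], [0, 0, 1, -1]), ([1, 0, 0, -1], [0, 1, 0, 1]), ([1, -1, 0, 0], [0, 1, -1, 0]),
   ([1, 0, -1, 0], [0, 0, 1, 1])]

/-- Twelve disjoint triangles among the roots of `D₅`. -/
def triangles₅ : List (List ℤ × List ℤ) :=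
  [([0, 0, 1, 1, 0], [0, 0, 0, -1, -1]), ([1, 0, 0, -1, 0], [0, -1, 0, 1, 0]),
   ([1, 0, 0, 1, 0], [0, 0, -1, -1, 0]), ([0, 1, -1, 0, 0], [0, 0, 1, 0, 1]),
   ([1, 0, 0, 0, -1], [0, 0, 0, -1, 1]), ([0, 1, 0, 0, 1], [0, 0, 1, 0, -1]),
   ([0, 0, 1, -1, 0], [0, 0, 0, 1, 1]), ([1, -1, 0, 0, 0], [0, 1, 0, 0, -1]),
   ([1, 0, -1, 0, 0], [0, 1, 1, 0, 0]), ([1, 0, 0, 0, 1], [0, 0, 0, 1, -1]),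
   ([0, 1, 0, -1, 0], [0, 0, -1, 1, 0]), ([1, 1, 0, 0, 0], [0, -1, 0, 0, 1])]

/-- The roots of `E₆`, for a sum of three forms `x² + 3y²`, as twenty-four triangles. -/
def triangles₆ : List (List ℤ × List ℤ) :=
  [([0, 2, 0, 0, 0, 0], [-3, -1, 0, 0, 0, 0]), ([0, -2, 0, 0, 0, 0], [3, 1, 0, 0, 0, 0]),
   ([0, 0, 0, 2, 0, 0], [0, 0, -3, -1, 0, 0]), ([0, 0, 0, -2, 0, 0], [0, 0, 3, 1, 0, 0]),
   ([0, 0, 0, 0, 0, 2], [0, 0, 0, 0, -3, -1]), ([0, 0, 0, 0, 0, -2], [0, 0, 0, 0, 3, 1]),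
   ([2, 0, 2, 0, 2, 0], [-1, 1, -1, 1, -1, 1]), ([2, 0, 2, 0, -1, 1], [-1, 1, -1, 1, -1, -1]),
   ([2, 0, 2, 0, -1, -1], [-1, 1, -1, 1, 2, 0]), ([2, 0, -1, 1, 2, 0], [-1, 1, -1, -1, -1, 1]),
   ([2, 0, -1, 1, -1, 1], [-1, 1, -1, -1, -1, -1]),
   ([2, 0, -1, 1, -1, -1], [-1, 1, -1, -1, 2, 0]), ([2, 0, -1, -1, 2, 0], [-1, 1, 2, 0, -1, 1]),
   ([2, 0, -1, -1, -1, 1], [-1, 1, 2, 0, -1, -1]),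
   ([2, 0, -1, -1, -1, -1], [-1, 1, 2, 0, 2, 0]),
   ([-2, 0, -2, 0, -2, 0], [1, -1, 1, -1, 1, -1]),
   ([-2, 0, -2, 0, 1, -1], [1, -1, 1, -1, 1, 1]), ([-2, 0, -2, 0, 1, 1], [1, -1, 1, -1, -2, 0]),
   ([-2, 0, 1, -1, -2, 0], [1, -1, 1, 1, 1, -1]), ([-2, 0, 1, -1, 1, -1], [1, -1, 1, 1, 1, 1]),
   ([-2, 0, 1, -1, 1, 1], [1, -1, 1, 1, -2, 0]), ([-2, 0, 1, 1, -2, 0], [1, -1, -2, 0, 1, -1]),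
   ([-2, 0, 1, 1, 1, -1], [1, -1, -2, 0, 1, 1]), ([-2, 0, 1, 1, 1, 1], [1, -1, -2, 0, -2, 0])]

/-- The roots of `E₇` as forty-two triangles. -/
def triangles₇ : List (List ℤ × List ℤ) :=
  [([1, -1, 0, -1, 0, 0, 1], [0, 0, 0, 2, 0, 0, 0]),
   ([1, 0, -1, 0, -1, 0, 1], [0, 1, 1, 0, 0, 1, -1]),
   ([1, 1, 0, 1, 0, 0, 1], [0, -1, -1, 0, 0, -1, -1]),
   ([0, 1, 1, 1, -1, 0, 0], [0, 1, -1, -1, 1, 0, 0]),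
   ([1, 0, -1, 0, 1, 0, 1], [0, 0, 0, -1, -1, -1, -1]),
   ([1, 0, 1, 0, 1, 0, 1], [0, 1, -1, -1, -1, 0, 0]),
   ([1, 0, 1, 1, 0, 1, 0], [0, -1, -1, -1, -1, 0, 0]),
   ([1, 1, 0, 0, 1, 1, 0], [0, -1, 1, -1, -1, 0, 0]),
   ([1, 0, 1, 0, 1, 0, -1], [0, 0, 0, 1, -1, 1, 1]),
   ([0, 1, -1, 1, -1, 0, 0], [0, 0, 2, 0, 0, 0, 0]),
   ([1, 1, 0, 0, 1, -1, 0], [0, -1, 1, 0, 0, 1, 1]),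
   ([1, 0, 1, 0, -1, 0, 1], [0, 0, -2, 0, 0, 0, 0]),
   ([0, 1, -1, 0, 0, -1, 1], [0, 0, 0, -1, -1, 1, -1]),
   ([0, 1, 1, 0, 0, 1, 1], [0, 0, 0, -1, 1, -1, -1]),
   ([0, 1, -1, 0, 0, -1, -1], [0, 0, 0, -1, 1, 1, 1]),
   ([1, -1, 0, 0, -1, -1, 0], [0, 1, -1, 0, 0, 1, -1]),
   ([0, 0, 0, 1, 1, -1, 1], [0, 0, 0, 0, -2, 0, 0]),
   ([1, -1, 0, 1, 0, 0, 1], [0, 1, 1, 0, 0, -1, -1]),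
   ([1, 1, 0, 1, 0, 0, -1], [0, 0, 0, 0, 0, 0, 2]),
   ([1, 0, -1, 0, 1, 0, -1], [0, 1, 1, -1, -1, 0, 0]),
   ([0, 1, 1, 0, 0, -1, 1], [0, 0, 0, 0, 0, 0, -2]),
   ([1, -1, 0, 0, 1, 1, 0], [0, 0, 0, 0, 0, -2, 0]),
   ([1, 1, 0, -1, 0, 0, 1], [0, 0, 0, 1, -1, -1, -1]),
   ([1, 0, 1, 1, 0, -1, 0], [0, 0, 0, -1, -1, 1, 1]),
   ([0, 0, 0, 1, 1, 1, -1], [0, 0, 0, 1, -1, -1, 1]),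
   ([1, -1, 0, -1, 0, 0, -1], [0, 1, -1, 0, 0, 1, 1]),
   ([2, 0, 0, 0, 0, 0, 0], [-1, 0, 1, 0, -1, 0, -1]),
   ([1, 1, 0, 0, -1, -1, 0], [0, -1, 1, -1, 1, 0, 0]),
   ([1, -1, 0, 0, -1, 1, 0], [0, 0, 0, -1, 1, -1, 1]),
   ([1, 0, -1, -1, 0, -1, 0], [0, 1, 1, 1, 1, 0, 0]),
   ([1, 0, -1, 0, -1, 0, -1], [0, 0, 0, 1, 1, 1, 1]),
   ([1, 1, 0, -1, 0, 0, -1], [0, -1, -1, 1, 1, 0, 0]),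
   ([1, -1, 0, 0, 1, -1, 0], [0, 0, 0, 0, 0, 2, 0]),
   ([1, 0, -1, -1, 0, 1, 0], [0, -1, 1, 0, 0, -1, -1]),
   ([0, 2, 0, 0, 0, 0, 0], [0, -1, 1, 0, 0, -1, 1]),
   ([1, 0, 1, -1, 0, -1, 0], [1, 0, -1, 1, 0, 1, 0]),
   ([1, 0, -1, 1, 0, -1, 0], [0, -1, 1, 0, 0, 1, -1]),
   ([1, 0, 1, -1, 0, 1, 0], [0, 0, 0, 1, 1, -1, -1]),
   ([1, 1, 0, 0, -1, 1, 0], [0, 0, 0, 0, 2, 0, 0]),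
   ([1, 0, 1, 0, -1, 0, -1], [0, 1, -1, 1, 1, 0, 0]),
   ([1, -1, 0, 1, 0, 0, -1], [0, 0, 0, -1, -1, -1, 1]),
   ([0, 1, 1, -1, 1, 0, 0], [0, 0, 0, 1, -1, 1, -1])]

theorem isLabelledCode_antipodal : IsLabelledCode [1] 1 [(0, [1]), (0, [-1])] :=
  ⟨by decide, by decide, by decide⟩

theorem isLabelledCode_triangles₂ : IsLabelledCode [1, 3] 4 (labelledVertices triangles₂) :=
  ⟨by decide +kernel, by decide +kernel, by decide +kernel⟩

theorem isLabelledCode_triangles₃ : IsLabelledCode [1, 1, 1] 2 (labelledVertices triangles₃) :=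
  ⟨by decide +kernel, by decide +kernel, by decide +kernel⟩

theorem isLabelledCode_triangles₄ : IsLabelledCode [1, 1, 1, 1] 2 (labelledVertices triangles₄) :=
  ⟨by decide +kernel, by decide +kernel, by decide +kernel⟩

theorem isLabelledCode_triangles₅ :
    IsLabelledCode [1, 1, 1, 1, 1] 2 (labelledVertices triangles₅) :=
  ⟨by decide +kernel, by decide +kernel, by decide +kernel⟩

theorem isLabelledCode_triangles₆ :
    IsLabelledCode [1, 3, 1, 3, 1, 3] 12 (labelledVertices triangles₆) :=
  ⟨by decide +kernel, by decide +kernel, by decide +kernel⟩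

theorem isLabelledCode_triangles₇ :
    IsLabelledCode [1, 1, 1, 1, 1, 1, 1] 4 (labelledVertices triangles₇) :=
  ⟨by decide +kernel, by decide +kernel, by decide +kernel⟩

/-- Each triangle uses up one layer and puts back three copies of it, a net gain of 2 · 512. There
are 64 layers to draw on. -/
theorem le_kissingNumber_of_triangles {c : List ℕ} {N : ℕ} (hN : 0 < N)
    {T : List (List ℤ × List ℤ)} (hT : IsLabelledCode c N (labelledVertices T))
    (h64 : T.length ≤ 64) :
    ((196560 + T.length * 1024 : ℕ) : ℕ∞) ≤ kissingNumber (24 + c.length) := by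
  have hlen : (labelledVertices T).length = 3 * T.length := by
    simp [labelledVertices, List.length_flatMap, mul_comm]
  have h := le_kissingNumber_of_labelledCode hN hT (l := T.length) (fun p hp => ?_) h64
  · rw [hlen] at h
    refine le_trans (Nat.cast_le.2 ?_) h
    omega
  · simp only [labelledVertices, List.mem_flatMap] at hp
    obtain ⟨t, ht, hp⟩ := hp
    have : t.2 < T.length := by simpa using List.snd_lt_of_mem_zipIdx ht
    simp only [List.mem_cons, List.not_mem_nil, or_false] at hp
    rcases hp with rfl | rfl | rfl <;> exact this

theorem theorem3p1 :
    197048 ≤ kissingNumber 25 ∧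
    198512 ≤ kissingNumber 26 ∧
    199976 ≤ kissingNumber 27 ∧
    204368 ≤ kissingNumber 28 ∧
    208272 ≤ kissingNumber 29 ∧
    219984 ≤ kissingNumber 30 ∧
    232874 ≤ kissingNumber 31 := by
  -- The configurations have 197072, 198608, 200656, 204752, 208848, 221136 and 239568 spheres, more
  -- than is claimed in each dimension.
  refine ⟨?_, ?_, ?_, ?_, ?_, ?_, ?_⟩
  · exact le_trans (by norm_num) (le_kissingNumber_of_labelledCode one_pos
      isLabelledCode_antipodal (l := 1) (by decide) (by norm_num))
  · exact le_trans (by norm_num [triangles₂]) (le_kissingNumber_of_triangles (by norm_num)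
      isLabelledCode_triangles₂ (by decide))
  · exact le_trans (by norm_num [triangles₃]) (le_kissingNumber_of_triangles (by norm_num)
      isLabelledCode_triangles₃ (by decide))
  · exact le_trans (by norm_num [triangles₄]) (le_kissingNumber_of_triangles (by norm_num)
      isLabelledCode_triangles₄ (by decide))
  · exact le_trans (by norm_num [triangles₅]) (le_kissingNumber_of_triangles (by norm_num)
      isLabelledCode_triangles₅ (by decide))
  · exact le_trans (by norm_num [triangles₆]) (le_kissingNumber_of_triangles (by norm_num)
      isLabelledCode_triangles₆ (by decide))
  · exact le_trans (by norm_num [triangles₇]) (le_kissingNumber_of_triangles (by norm_num)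
      isLabelledCode_triangles₇ (by decide))
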